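/- A 2-layer drawing of a finite bipartite graph with bipartition $(X,Y)$ is a pair of bijections $\pi_X\colon X\to\{1,\dots,|X|\}$, $\pi_Y\colon Y\to\{1,\dots,|Y|\}$. Edges $x_1y_1$ and $x_2y_2$ ($x_i\in X$, $y_i\in Y$) cross if either $\pi_X(x_1)<\pi_X(x_2)$ and $\pi_Y(y_1)>\pi_Y(y_2)$, or $\pi_X(x_1)>\pi_X(x_2)$ and $\pi_Y(y_1)<\pi_Y(y_2)$. A finite bipartite graph is 2-layer $k$-planar if, for some bipartition, it has a 2-layer drawing in which every edge crosses at most $k$ edges. Write $[n]=\{1,\dots,n\}$. Theorem. For every integer $k\ge 0$ there is a finite bipartite graph that is 2-layer $k$-planar and has pathwidth exactly $k+1$. For every $k\ge 1$ the graph $W_k$ defined below is such a graph, and it contains the graph $G_k$ defined below as a minor. The graph $G_k$ has vertex set $[k+2]\times[3k+6]$ and the edges $\{(x,y),(x+1,y)\}$ for $x\in[k+1]$, $y\in[3k+6]$, and $\{(x,y),(x,y+1)\}$ for $x\in[k]$, $y\in[3k+5]$. The graph $W_k$ has the vertices $(x,y)$ with $x\in[k]$, $y\in[4k(3k+6)]$,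 and the vertices $(k+1,4kt-2)$ and $(k+2,4kt-1)$ for $t\in[3k+6]$. Its edges are $\{(x,y),(x,y+1)\}$ for $x\in[k]$, $y\in[4k(3k+6)-1]$, and, for each $t\in[3k+6]$, the edges $\{(x,4k(t-1)+4x-3),(x+1,4k(t-1)+4x-2)\}$ for $x\in[k-1]$, and $\{(k,4kt-3),(k+1,4kt-2)\}$, $\{(k+1,4kt-2),(k+2,4kt-1)\}$. -/

import Mathlib

namespace TwoLayer

/-- A 2-layer drawing of a (finite) graph `G`: a bipartition `(X, Y)` of `G` together with
bijections `πX : X → [|X|]` and `πY : Y → [|Y|]`, giving the order of the vertices on the two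
layers. The bijections force `X` and `Y`, hence the graph, to be finite. -/
structure Drawing {V : Type*} (G : SimpleGraph V) where
  /-- the vertices on the first layer -/
  X : Set V
  /-- the vertices on the second layer -/
  Y : Set V
  /-- `X` and `Y` are disjoint, and every edge joins a vertex of `X` with a vertex of `Y` -/
  isBipartiteWith : G.IsBipartiteWith X Y
  /-- every vertex lies on one of the layers -/
  union_eq : X ∪ Y = Set.univ
  /-- the positions on the first layer -/
  πX : X ≃ Fin (Nat.card X)
  /-- the positions on the second layer -/
  πY : Y ≃ Fin (Nat.card Y)

/-- The edge `{x₁, y₁}` crosses the edge `{x₂, y₂}`; an edge is written as the pair of its end in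
`X` and its end in `Y`. -/
def Drawing.Crosses {V : Type*} {G : SimpleGraph V} (D : Drawing G) (e f : D.X × D.Y) : Prop :=
  (D.πX e.1 < D.πX f.1 ∧ D.πY f.2 < D.πY e.2) ∨ (D.πX f.1 < D.πX e.1 ∧ D.πY e.2 < D.πY f.2)

/-- Every edge is crossed by at most `k` edges. (Each edge of `G` is exactly one pair in
`X × Y`, so counting pairs is counting edges.) -/
def Drawing.IsKPlanar {V : Type*} {G : SimpleGraph V} (D : Drawing G) (k : ℕ) : Prop :=
  ∀ e : D.X × D.Y, G.Adj e.1 e.2 →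
    {f : D.X × D.Y | G.Adj f.1 f.2 ∧ D.Crosses e f}.ncard ≤ k

/-- `G` is a 2-layer `k`-planar graph. -/
def IsKPlanar {V : Type*} (G : SimpleGraph V) (k : ℕ) : Prop :=
  ∃ D : Drawing G, D.IsKPlanar k

/-- A path decomposition of a finite graph: the path has the vertices `0, 1, …, n` in this order,
and a set of vertices induces a connected subgraph of it iff it is an interval. -/
structure PathDecomposition {V : Type*} (G : SimpleGraph V) where
  /-- the length of the path -/
  n : ℕ
  /-- the bags -/
  bag : Fin (n + 1) → Finset V
  /-- every vertex is in a bag -/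
  exists_mem : ∀ v, ∃ p, v ∈ bag p
  /-- the ends of every edge are in a common bag -/
  exists_mem_of_adj : ∀ u v, G.Adj u v → ∃ p, u ∈ bag p ∧ v ∈ bag p
  /-- the bags that contain a vertex are consecutive -/
  mem_of_le_of_le : ∀ v, ∀ p q r : Fin (n + 1), p ≤ q → q ≤ r → v ∈ bag p → v ∈ bag r → v ∈ bag q

/-- The width: the maximal size of a bag, minus one. -/
def PathDecomposition.width {V : Type*} {G : SimpleGraph V} (D : PathDecomposition G) : ℤ :=
  ((Finset.univ.sup fun p => (D.bag p).card : ℕ) : ℤ) - 1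

/-- The pathwidth of a finite graph: the minimal width of a path decomposition. -/
noncomputable def pathwidth {V : Type*} (G : SimpleGraph V) : ℤ :=
  sInf (Set.range fun D : PathDecomposition G => D.width)

/-- `H` is a minor of `G`: there are pairwise disjoint sets of vertices of `G`, one for each vertex
of `H`, that induce connected (in particular nonempty) subgraphs, such that there is an edge of `G`
between the sets of any two adjacent vertices of `H`. -/
def IsMinor {U V : Type*} (H : SimpleGraph U) (G : SimpleGraph V) : Prop :=
  ∃ S : U → Set V,
    (∀ u, (G.induce (S u)).Connected) ∧
    (∀ u v, u ≠ v → Disjoint (S u) (S v)) ∧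
    (∀ u v, H.Adj u v → ∃ a ∈ S u, ∃ b ∈ S v, G.Adj a b)

/-- The vertices `[k + 2] × [3k + 6]` of the grid-like graph; `(x, y)` is in row `x`,
column `y`. -/
def gridVertices (k : ℕ) : Finset (ℕ × ℕ) :=
  Finset.Icc 1 (k + 2) ×ˢ Finset.Icc 1 (3 * k + 6)

/-- The grid-like graph `G_k`: all the column edges, and the row edges in the rows `1, …, k`. -/
def grid (k : ℕ) : SimpleGraph (gridVertices k) :=
  SimpleGraph.fromRel fun p q =>
    (q.1.1 = p.1.1 + 1 ∧ q.1.2 = p.1.2) ∨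
    (p.1.1 ≤ k ∧ q.1.1 = p.1.1 ∧ q.1.2 = p.1.2 + 1)

/-- The vertices of the wall-like graph: `k` rows of `4k(3k + 6)` vertices each, and for each
`t ∈ [3k + 6]` the two hair vertices `(k + 1, 4kt - 2)` and `(k + 2, 4kt - 1)`. -/
def wallVertices (k : ℕ) : Finset (ℕ × ℕ) :=
  (Finset.Icc 1 k ×ˢ Finset.Icc 1 (4 * k * (3 * k + 6))) ∪
    ((Finset.Icc 1 (3 * k + 6)).image fun t => (k + 1, 4 * k * t - 2)) ∪
    ((Finset.Icc 1 (3 * k + 6)).image fun t => (k + 2, 4 * k * t - 1))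

/-- The wall-like graph `W_k` (for `k ≥ 1`, where no subtraction below is truncated): the row edges
in the rows `1, …, k`, and for each `t ∈ [3k + 6]` an edge between the rows `x` and `x + 1` for each
`x ∈ [k - 1]`, and a hair of two edges attached to row `k`. -/
def wall (k : ℕ) : SimpleGraph (wallVertices k) :=
  SimpleGraph.fromRel fun p q =>
    (p.1.1 ≤ k ∧ q.1.1 = p.1.1 ∧ q.1.2 = p.1.2 + 1) ∨
    ∃ t ∈ Finset.Icc 1 (3 * k + 6),
      (∃ x ∈ Finset.Icc 1 (k - 1),
        p.1 = (x, 4 * k * (t - 1) + 4 * x - 3) ∧ q.1 = (x + 1, 4 * k * (t - 1) + 4 * x - 2)) ∨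
      (p.1 = (k, 4 * k * t - 3) ∧ q.1 = (k + 1, 4 * k * t - 2)) ∨
      (p.1 = (k + 1, 4 * k * t - 2) ∧ q.1 = (k + 2, 4 * k * t - 1))

end TwoLayer

/-!
The wall-like graph `W_k` is ordered by columns, and by rows within a column. Every edge joins two
consecutive columns, so the parities of the columns give the two layers, and each layer inherits
the order. Row edges `x` and `x'` of consecutive gaps between columns cross if and only if they are
on the appropriate sides of each other, which makes at most `k - 1` crossings for each row edge; the
edges that change the row cross at most `k` row edges each, and are so far apart that each row edge
crosses at most one of them (`wall_isKPlanar`). Sweeping over the same order gives a path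
decomposition with bags of at most `k + 2` vertices: one vertex for each of the `k` rows, the
current vertex, and at most one end of an edge that changes the row (`wall_ofKey_width_le`).

For the lower bound, each block of `4 * k` columns of `W_k` becomes a column of the grid-like graph
`G_k`, which is thus a minor (`grid_isMinor_wall`), and pathwidth is minor-monotone
(`IsMinor.le_width`). In a path decomposition of `G_k`, a connected set meets an interval of bags.
Each of the `k` full rows meets the column that ends first and the column that starts last, and so
every bag between them. As bags are small and there are many disjoint columns, some column lives
strictly in between. The bag that contains its last edge contains two vertices outside the `k` rows,
and hence at least `k + 2` vertices (`grid_le_width`).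

For `k = 0` a single edge is an example.
-/

namespace TwoLayer

/-! ### Connected sets and path decompositions -/

/-- A set is connected as soon as every vertex but a root `r` has a neighbour in the set that is
closer to the root, as measured by `h`. -/
theorem connected_induce_of_descent {V : Type*} {G : SimpleGraph V} {S : Set V} (h : V → ℕ)
    (r : V) (hr : r ∈ S) (hS : ∀ v ∈ S, v = r ∨ ∃ w ∈ S, G.Adj v w ∧ h w < h v) :
    (G.induce S).Connected := by
  rw [SimpleGraph.connected_iff_exists_forall_reachable]
  refine ⟨⟨r, hr⟩, ?_⟩
  suffices H : ∀ n, ∀ v (hv : v ∈ S), h v = n → (G.induce S).Reachable ⟨r, hr⟩ ⟨v, hv⟩ from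
    fun w => H _ w.1 w.2 rfl
  intro n
  induction n using Nat.strong_induction_on with
  | _ n ih =>
    intro v hv hn
    rcases hS v hv with rfl | ⟨w, hw, hvw, hlt⟩
    · exact SimpleGraph.Reachable.refl _
    · have hadj : (G.induce S).Adj ⟨w, hw⟩ ⟨v, hv⟩ := hvw.symm
      exact (ih _ (hn ▸ hlt) w hw rfl).trans hadj.reachable

namespace PathDecomposition

variable {U V : Type*} {G : SimpleGraph V}

/-- The bags that meet a connected set are consecutive. -/
theorem exists_mem_bag_of_connected (D : PathDecomposition G) {S : Set V}
    (hS : (G.induce S).Connected) {p q r : Fin (D.n + 1)} (hpq : p ≤ q) (hqr : q ≤ r)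
    (hp : ∃ v ∈ S, v ∈ D.bag p) (hr : ∃ v ∈ S, v ∈ D.bag r) : ∃ v ∈ S, v ∈ D.bag q := by
  obtain ⟨v, hvS, hv⟩ := hp
  obtain ⟨w, hwS, hw⟩ := hr
  by_contra! hq
  -- Along a walk in `S`, no vertex can leave the part of the path before `q`.
  have key : ∀ a b : S, (G.induce S).Walk a b →
      (∃ s < q, a.1 ∈ D.bag s) → ∃ s < q, b.1 ∈ D.bag s := by
    intro a b walk
    induction walk with
    | nil => exact id
    | @cons a c b hac _ ih =>
      rintro ⟨s, hs, has⟩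
      apply ih
      obtain ⟨t, hat, hct⟩ := D.exists_mem_of_adj _ _ (SimpleGraph.induce_adj.1 hac)
      refine ⟨t, ?_, hct⟩
      by_contra! hqt
      exact hq _ a.2 (D.mem_of_le_of_le _ _ _ _ hs.le hqt has hat)
  obtain ⟨walk⟩ := hS.preconnected ⟨v, hvS⟩ ⟨w, hwS⟩
  have hpq' : p < q := lt_of_le_of_ne hpq (by rintro rfl; exact hq v hvS hv)
  obtain ⟨s, hs, hws⟩ := key _ _ walk ⟨p, hpq', hv⟩
  exact hq w hwS (D.mem_of_le_of_le _ _ _ _ hs.le hqr hws hw)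

theorem width_le_iff (D : PathDecomposition G) (m : ℕ) :
    D.width ≤ m ↔ ∀ p, (D.bag p).card ≤ m + 1 := by
  have : (Finset.univ.sup fun p => (D.bag p).card) ≤ m + 1 ↔ ∀ p, (D.bag p).card ≤ m + 1 := by
    simp
  rw [← this, width]
  omega

/-- The path decomposition of a minor `H` of `G` in which a bag consists of the vertices of `H`
whose branch sets meet the corresponding bag of `G`. -/
noncomputable def ofBranchSets [Fintype U] {H : SimpleGraph U} (D : PathDecomposition G)
    (S : U → Set V) (hconn : ∀ u, (G.induce (S u)).Connected)
    (hadj : ∀ u v, H.Adj u v → ∃ a ∈ S u, ∃ b ∈ S v, G.Adj a b) : PathDecomposition H where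
  n := D.n
  bag p := by
    classical
    exact Finset.univ.filter fun u => ∃ v ∈ S u, v ∈ D.bag p
  exists_mem u := by
    obtain ⟨⟨v, hv⟩⟩ := (hconn u).nonempty
    obtain ⟨p, hp⟩ := D.exists_mem v
    exact ⟨p, by simpa using ⟨v, hv, hp⟩⟩
  exists_mem_of_adj u v huv := by
    obtain ⟨a, ha, b, hb, hab⟩ := hadj u v huv
    obtain ⟨p, hpa, hpb⟩ := D.exists_mem_of_adj a b hab
    exact ⟨p, by simpa using ⟨a, ha, hpa⟩, by simpa using ⟨b, hb, hpb⟩⟩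
  mem_of_le_of_le u p q r hpq hqr hp hr := by
    simp only [Finset.mem_filter, Finset.mem_univ, true_and] at hp hr ⊢
    exact D.exists_mem_bag_of_connected (hconn u) hpq hqr hp hr

theorem card_bag_ofBranchSets_le [Fintype U] {H : SimpleGraph U} (D : PathDecomposition G)
    (S : U → Set V) (hconn : ∀ u, (G.induce (S u)).Connected)
    (hdisj : ∀ u v, u ≠ v → Disjoint (S u) (S v))
    (hadj : ∀ u v, H.Adj u v → ∃ a ∈ S u, ∃ b ∈ S v, G.Adj a b) (p : Fin (D.n + 1)) :
    ((D.ofBranchSets S hconn hadj).bag p).card ≤ (D.bag p).card := by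
  classical
  have hmem : ∀ u ∈ (D.ofBranchSets S hconn hadj).bag p, ∃ v, v ∈ S u ∧ v ∈ D.bag p := by
    intro u hu
    simpa [ofBranchSets] using hu
  refine Finset.card_le_card_of_forall_subsingleton (fun u v => v ∈ S u)
    (fun u hu => (hmem u hu).imp fun v hv => hv.symm) ?_
  rintro v - u ⟨-, hu⟩ u' ⟨-, hu'⟩
  by_contra hne
  exact Set.disjoint_left.1 (hdisj u u' hne) hu hu'

end PathDecomposition

/-- Pathwidth is minor-monotone: a lower bound for all path decompositions of a minor is one for
all path decompositions of the graph. -/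
theorem IsMinor.le_width {U V : Type*} [Fintype U] {H : SimpleGraph U} {G : SimpleGraph V}
    (h : IsMinor H G) {m : ℕ} (hm : ∀ D : PathDecomposition H, (m : ℤ) + 1 ≤ D.width)
    (D : PathDecomposition G) : (m : ℤ) + 1 ≤ D.width := by
  obtain ⟨S, hconn, hdisj, hadj⟩ := h
  have h1 := hm (D.ofBranchSets S hconn hadj)
  by_contra! hlt
  have h2 : ∀ p, (D.bag p).card ≤ m + 1 := (D.width_le_iff m).1 (by omega)
  have h3 := ((D.ofBranchSets S hconn hadj).width_le_iff m).2
    fun p => (D.card_bag_ofBranchSets_le S hconn hdisj hadj p).trans (h2 p)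
  omega

theorem pathwidth_eq_of_le_of_forall_le {V : Type*} {G : SimpleGraph V} {m : ℤ}
    (D : PathDecomposition G) (hD : D.width ≤ m)
    (hm : ∀ D' : PathDecomposition G, m ≤ D'.width) : pathwidth G = m := by
  apply IsLeast.csInf_eq
  refine ⟨⟨D, le_antisymm hD (hm D)⟩, ?_⟩
  rintro _ ⟨D', rfl⟩
  exact hm D'

/-- The path decomposition of an ordered graph whose bag at position `p` consists of the vertex at
`p` and of the earlier vertices that have a neighbour at `p` or later. Positions without a vertex
are allowed. -/
noncomputable def PathDecomposition.ofKey {V : Type*} [Fintype V] (G : SimpleGraph V)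
    (key : V → ℕ) : PathDecomposition G where
  n := Finset.univ.sup key
  bag p := by
    classical
    exact Finset.univ.filter fun v => key v ≤ p ∧ (key v = p ∨ ∃ w, G.Adj v w ∧ p ≤ key w)
  exists_mem v := by
    have := Finset.le_sup (f := key) (Finset.mem_univ v)
    exact ⟨⟨key v, by omega⟩, by simp⟩
  exists_mem_of_adj u v huv := by
    have hu := Finset.le_sup (f := key) (Finset.mem_univ u)
    have hv := Finset.le_sup (f := key) (Finset.mem_univ v)
    rcases le_total (key u) (key v) with h | h
    · exact ⟨⟨key v, by omega⟩, by simpa using ⟨h, Or.inr ⟨v, huv, le_rfl⟩⟩, by simp⟩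
    · exact ⟨⟨key u, by omega⟩, by simp, by simpa using ⟨h, Or.inr ⟨u, huv.symm, le_rfl⟩⟩⟩
  mem_of_le_of_le v p q r hpq hqr hp hr := by
    simp only [Finset.mem_filter, Finset.mem_univ, true_and, Fin.le_def] at hp hr hpq hqr ⊢
    refine ⟨hp.1.trans hpq, ?_⟩
    rcases hr.2 with h | ⟨w, hw, hrw⟩
    · left
      omega
    · exact Or.inr ⟨w, hw, hqr.trans hrw⟩

/-! ### The pathwidth of the grid-like graph -/

theorem mem_gridVertices {k : ℕ} {v : ℕ × ℕ} : v ∈ gridVertices k ↔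
    (1 ≤ v.1 ∧ v.1 ≤ k + 2) ∧ 1 ≤ v.2 ∧ v.2 ≤ 3 * k + 6 := by
  simp [gridVertices, Finset.mem_product]

theorem grid_connected_column {k j : ℕ} (h1 : 1 ≤ j) (h2 : j ≤ 3 * k + 6) :
    ((grid k).induce {v | v.1.2 = j}).Connected := by
  refine connected_induce_of_descent (fun v => v.1.1)
    ⟨(1, j), mem_gridVertices.2 ⟨⟨le_rfl, by omega⟩, h1, h2⟩⟩ rfl ?_
  rintro ⟨⟨x, y⟩, hv⟩ hj
  have hv' := mem_gridVertices.1 hv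
  simp only [Set.mem_ofPred_eq] at hj hv'
  subst hj
  by_cases hx : x = 1
  · left
    simp [hx]
  · refine Or.inr ⟨⟨(x - 1, y), mem_gridVertices.2 ⟨⟨?_, ?_⟩, h1, h2⟩⟩, rfl, ?_, ?_⟩
    · change 1 ≤ x - 1
      omega
    · change x - 1 ≤ k + 2
      omega
    · simp only [grid, SimpleGraph.fromRel_adj, ne_eq, Subtype.mk.injEq, Prod.mk.injEq, and_true]
      omega
    · change x - 1 < x
      omega

theorem grid_connected_row {k x : ℕ} (h1 : 1 ≤ x) (h2 : x ≤ k) :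
    ((grid k).induce {v | v.1.1 = x}).Connected := by
  refine connected_induce_of_descent (fun v => v.1.2)
    ⟨(x, 1), mem_gridVertices.2 ⟨⟨h1, by dsimp only; omega⟩, le_rfl, by omega⟩⟩ rfl ?_
  rintro ⟨⟨x', y⟩, hv⟩ hj
  have hv' := mem_gridVertices.1 hv
  simp only [Set.mem_ofPred_eq] at hj hv'
  subst hj
  by_cases hy : y = 1
  · left
    simp [hy]
  · refine Or.inr ⟨⟨(x', y - 1), mem_gridVertices.2 ⟨hv'.1, ?_, ?_⟩⟩, rfl, ?_, ?_⟩
    · change 1 ≤ y - 1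
      omega
    · change y - 1 ≤ 3 * k + 6
      omega
    · simp only [grid, SimpleGraph.fromRel_adj, ne_eq, Subtype.mk.injEq, Prod.mk.injEq, true_and]
      omega
    · change y - 1 < y
      omega

/-- If all bags had at most `k + 1` vertices, then some column would lie strictly between the last
bag of the column that ends first and the first bag of the column that starts last. Every bag in
between meets all `k` rows, so a bag that contains the last edge of that column has `k + 2`
vertices. -/
theorem grid_le_width {k : ℕ} (D : PathDecomposition (grid k)) : (k : ℤ) + 1 ≤ D.width := by
  classical
  by_contra! hlt
  have hcard := (D.width_le_iff k).1 (by omega)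
  let cols := Finset.Icc 1 (3 * k + 6)
  have hcols : cols.Nonempty := ⟨1, Finset.mem_Icc.2 ⟨le_rfl, by omega⟩⟩
  let M : ℕ → Fin (D.n + 1) → Prop := fun j p =>
    ∃ v ∈ {v : gridVertices k | v.1.2 = j}, v ∈ D.bag p
  have hM : ∀ {x j : ℕ}, 1 ≤ x → x ≤ k + 2 → j ∈ cols →
      ∃ p, ∃ v ∈ D.bag p, v.1.1 = x ∧ v.1.2 = j := by
    intro x j hx hx' hj
    obtain ⟨p, hp⟩ := D.exists_mem ⟨(x, j), mem_gridVertices.2 ⟨⟨hx, hx'⟩, Finset.mem_Icc.1 hj⟩⟩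
    exact ⟨p, _, hp, rfl, rfl⟩
  have hlast : ∀ j ∈ cols, ∃ p, M j p ∧ ∀ q, M j q → q ≤ p := by
    intro j hj
    obtain ⟨p, v, hv, -, hvj⟩ := hM le_rfl (by omega) hj
    obtain ⟨q, hq, hmax⟩ := Finset.exists_max_image (Finset.univ.filter (M j)) id
      ⟨p, Finset.mem_filter.2 ⟨Finset.mem_univ _, v, hvj, hv⟩⟩
    exact ⟨q, (Finset.mem_filter.1 hq).2, fun r hr => hmax r (by simpa using hr)⟩
  have hfirst : ∀ j ∈ cols, ∃ p, M j p ∧ ∀ q, M j q → p ≤ q := by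
    intro j hj
    obtain ⟨p, v, hv, -, hvj⟩ := hM le_rfl (by omega) hj
    obtain ⟨q, hq, hmin⟩ := Finset.exists_min_image (Finset.univ.filter (M j)) id
      ⟨p, Finset.mem_filter.2 ⟨Finset.mem_univ _, v, hvj, hv⟩⟩
    exact ⟨q, (Finset.mem_filter.1 hq).2, fun r hr => hmin r (by simpa using hr)⟩
  choose! last hlastM hlast using hlast
  choose! first hfirstM hfirst using hfirst
  obtain ⟨A, hA, hAmin⟩ := Finset.exists_min_image cols last hcols
  obtain ⟨B, hB, hBmax⟩ := Finset.exists_max_image cols first hcols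
  -- Two bags meet at most `2 * (k + 1)` columns.
  obtain ⟨j, hj, hjAB⟩ : ∃ j ∈ cols,
      j ∉ (D.bag (last A)).image (fun v => v.1.2) ∪ (D.bag (first B)).image (fun v => v.1.2) := by
    apply Finset.exists_mem_notMem_of_card_lt_card
    calc _ ≤ _ := Finset.card_union_le _ _
      _ ≤ (k + 1) + (k + 1) := Nat.add_le_add (Finset.card_image_le.trans (hcard _))
          (Finset.card_image_le.trans (hcard _))
      _ < cols.card := by simp only [cols, Nat.card_Icc]; omega
  rw [Finset.mem_union, not_or] at hjAB
  have hjA : ¬ M j (last A) := fun ⟨v, hvj, hv⟩ => hjAB.1 (Finset.mem_image.2 ⟨v, hv, hvj⟩)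
  have hjB : ¬ M j (first B) := fun ⟨v, hvj, hv⟩ => hjAB.2 (Finset.mem_image.2 ⟨v, hv, hvj⟩)
  obtain ⟨hj1, hj2⟩ := Finset.mem_Icc.1 hj
  let u : gridVertices k :=
    ⟨(k + 1, j), mem_gridVertices.2 ⟨⟨by simp, by simp⟩, hj1, hj2⟩⟩
  let w : gridVertices k :=
    ⟨(k + 2, j), mem_gridVertices.2 ⟨⟨by simp, le_rfl⟩, hj1, hj2⟩⟩
  obtain ⟨s, hus, hws⟩ := D.exists_mem_of_adj u w (by simp [grid, u, w])
  have hjs : M j s := ⟨u, rfl, hus⟩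
  have hAs : last A ≤ s := by
    by_contra! hs
    exact hjA (D.exists_mem_bag_of_connected (grid_connected_column hj1 hj2) hs.le (hAmin j hj)
      hjs (hlastM j hj))
  have hsB : s ≤ first B := by
    by_contra! hs
    exact hjB (D.exists_mem_bag_of_connected (grid_connected_column hj1 hj2) (hBmax j hj) hs.le
      (hfirstM j hj) hjs)
  have hrows : Finset.Icc 1 (k + 2) ⊆ (D.bag s).image (fun v => v.1.1) := by
    intro x hx
    obtain ⟨hx1, hx2⟩ := Finset.mem_Icc.1 hx
    rw [Finset.mem_image]
    by_cases hxk : x ≤ k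
    · obtain ⟨p, v, hv, hvx, hvA⟩ := hM hx1 hx2 hA
      obtain ⟨q, v', hv', hvx', hvB⟩ := hM hx1 hx2 hB
      obtain ⟨z, hz, hzs⟩ := D.exists_mem_bag_of_connected (grid_connected_row hx1 hxk)
        ((hlast A hA p ⟨v, hvA, hv⟩).trans hAs) (hsB.trans (hfirst B hB q ⟨v', hvB, hv'⟩))
        ⟨v, hvx, hv⟩ ⟨v', hvx', hv'⟩
      exact ⟨z, hzs, hz⟩
    · obtain rfl | rfl : x = k + 1 ∨ x = k + 2 := by omega
      · exact ⟨u, hus, rfl⟩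
      · exact ⟨w, hws, rfl⟩
  have h1 := Finset.card_le_card hrows
  have h2 : ((D.bag s).image (fun v => v.1.1)).card ≤ k + 1 :=
    Finset.card_image_le.trans (hcard s)
  simp only [Nat.card_Icc] at h1
  omega

/-! ### The structure of the wall-like graph -/

theorem eq_of_mul_add_eq {k s s' c c' : ℕ} (h : k * s + c = k * s' + c')
    (hc : 1 ≤ c) (hck : c ≤ k) (hc' : 1 ≤ c') (hck' : c' ≤ k) : s = s' ∧ c = c' := by
  have : s = s' := by
    rcases lt_trichotomy s s' with hlt | heq | hlt
    · obtain ⟨d, rfl⟩ := Nat.exists_eq_add_of_lt hlt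
      have : k * (s + d + 1) = k * s + k * d + k := by ring
      have := Nat.zero_le (k * d)
      omega
    · exact heq
    · obtain ⟨d, rfl⟩ := Nat.exists_eq_add_of_lt hlt
      have : k * (s' + d + 1) = k * s' + k * d + k := by ring
      have := Nat.zero_le (k * d)
      omega
  subst this
  exact ⟨rfl, by omega⟩

theorem mem_wallVertices {k : ℕ} {v : ℕ × ℕ} : v ∈ wallVertices k ↔
    ((1 ≤ v.1 ∧ v.1 ≤ k) ∧ 1 ≤ v.2 ∧ v.2 ≤ 4 * k * (3 * k + 6)) ∨
    (∃ t, (1 ≤ t ∧ t ≤ 3 * k + 6) ∧ v = (k + 1, 4 * k * t - 2)) ∨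
    (∃ t, (1 ≤ t ∧ t ≤ 3 * k + 6) ∧ v = (k + 2, 4 * k * t - 1)) := by
  simp only [wallVertices, Finset.mem_union, Finset.mem_product, Finset.mem_Icc, Finset.mem_image,
    or_assoc, eq_comm (a := v)]

theorem wall_row_bounds {k : ℕ} (v : wallVertices k) : 1 ≤ v.1.1 ∧ v.1.1 ≤ k + 2 := by
  rcases mem_wallVertices.1 v.2 with h | ⟨t, -, h⟩ | ⟨t, -, h⟩
  · omega
  · rw [h]
    simp
  · rw [h]
    simp

/-- The pairs of positions that an edge of the wall-like graph can join. An edge always leads from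
a column to the next one; it stays in its row `x ≤ k` or leads from row `x` and column `y` to row
`x + 1`. In the latter case, `y` is `4 * x - 3` modulo `4 * k` if `x ≤ k`, and `2` modulo `4` if
`x = k + 1`. -/
def WallStep (k : ℕ) (p q : ℕ × ℕ) : Prop :=
  q.2 = p.2 + 1 ∧ 1 ≤ p.1 ∧
    ((q.1 = p.1 ∧ p.1 ≤ k) ∨
      (q.1 = p.1 + 1 ∧
        ((p.1 ≤ k ∧ ∃ s, p.2 + 3 = 4 * (k * s + p.1)) ∨ (p.1 = k + 1 ∧ p.2 % 4 = 2))))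

theorem WallStep.mod_four {k : ℕ} {p q : ℕ × ℕ} (h : WallStep k p q) :
    q.2 = p.2 + 1 ∧ 1 ≤ p.1 ∧
    ((q.1 = p.1 ∧ p.1 ≤ k) ∨
      (q.1 = p.1 + 1 ∧ ((p.1 ≤ k ∧ p.2 % 4 = 1) ∨ (p.1 = k + 1 ∧ p.2 % 4 = 2)))) := by
  obtain ⟨h1, h2, h3 | ⟨h3, ⟨h4, s, h5⟩ | h4⟩⟩ := h
  · exact ⟨h1, h2, Or.inl h3⟩
  · exact ⟨h1, h2, Or.inr ⟨h3, Or.inl ⟨h4, by omega⟩⟩⟩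
  · exact ⟨h1, h2, Or.inr ⟨h3, Or.inr h4⟩⟩

theorem WallStep.of_wall_adj {k : ℕ} (hk : 1 ≤ k) {p q : wallVertices k} (h : (wall k).Adj p q) :
    WallStep k p.1 q.1 ∨ WallStep k q.1 p.1 := by
  have key : ∀ p q : wallVertices k,
      ((p.1.1 ≤ k ∧ q.1.1 = p.1.1 ∧ q.1.2 = p.1.2 + 1) ∨
      ∃ t ∈ Finset.Icc 1 (3 * k + 6),
        (∃ x ∈ Finset.Icc 1 (k - 1),
          p.1 = (x, 4 * k * (t - 1) + 4 * x - 3) ∧ q.1 = (x + 1, 4 * k * (t - 1) + 4 * x - 2)) ∨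
        (p.1 = (k, 4 * k * t - 3) ∧ q.1 = (k + 1, 4 * k * t - 2)) ∨
        (p.1 = (k + 1, 4 * k * t - 2) ∧ q.1 = (k + 2, 4 * k * t - 1))) →
      WallStep k p.1 q.1 := by
    rintro p q (⟨h1, h2, h3⟩ | ⟨t, ht, h⟩)
    · exact ⟨h3, (wall_row_bounds p).1, Or.inl ⟨h2, h1⟩⟩
    · obtain ⟨s, rfl⟩ : ∃ s, t = s + 1 := ⟨t - 1, by have := (Finset.mem_Icc.1 ht).1; omega⟩
      have e1 : 4 * k * (s + 1) = 4 * (k * s) + 4 * k := by ring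
      have e2 : 4 * k * s = 4 * (k * s) := by ring
      rw [e1, Nat.add_sub_cancel, e2] at h
      rcases h with ⟨x, hx, hp, hq⟩ | ⟨hp, hq⟩ | ⟨hp, hq⟩
      · have := Finset.mem_Icc.1 hx
        rw [hp, hq]
        refine ⟨?_, ?_, Or.inr ⟨rfl, Or.inl ⟨?_, s, ?_⟩⟩⟩ <;> dsimp only <;> omega
      · rw [hp, hq]
        refine ⟨?_, hk, Or.inr ⟨rfl, Or.inl ⟨le_rfl, s, ?_⟩⟩⟩ <;> dsimp only <;> omega
      · rw [hp, hq]
        refine ⟨?_, ?_, Or.inr ⟨rfl, Or.inr ⟨rfl, ?_⟩⟩⟩ <;> dsimp only <;> omega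
  exact ((SimpleGraph.fromRel_adj _ _ _).1 h).2.imp (key p q) (key q p)

/-- The position of a vertex of the wall-like graph in the order by columns, and by rows within a
column. -/
def wallKey (k : ℕ) (v : ℕ × ℕ) : ℕ := v.2 * (k + 3) + v.1

theorem mul_add_lt_iff {m y y' x x' : ℕ} (hx : x < m) (hx' : x' < m) :
    y * m + x < y' * m + x' ↔ y < y' ∨ (y = y' ∧ x < x') := by
  rcases lt_trichotomy y y' with h | rfl | h
  · obtain ⟨d, rfl⟩ := Nat.exists_eq_add_of_lt h
    have : (y + d + 1) * m = y * m + d * m + m := by ring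
    have := Nat.zero_le (d * m)
    omega
  · omega
  · obtain ⟨d, rfl⟩ := Nat.exists_eq_add_of_lt h
    have : (y' + d + 1) * m = y' * m + d * m + m := by ring
    have := Nat.zero_le (d * m)
    omega

theorem wallKey_lt_iff {k : ℕ} (v w : wallVertices k) : wallKey k v.1 < wallKey k w.1 ↔
    v.1.2 < w.1.2 ∨ (v.1.2 = w.1.2 ∧ v.1.1 < w.1.1) :=
  mul_add_lt_iff (by have := wall_row_bounds v; omega) (by have := wall_row_bounds w; omega)

theorem wallKey_injective (k : ℕ) :
    Function.Injective fun v : wallVertices k => wallKey k v.1 := by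
  intro v w h
  have h1 := (wallKey_lt_iff v w).not.1 h.not_lt
  have h2 := (wallKey_lt_iff w v).not.1 h.not_gt
  apply Subtype.ext
  apply Prod.ext <;> omega

/-! ### A path decomposition of the wall-like graph -/

theorem wall_ofKey_width_le {k : ℕ} (hk : 1 ≤ k) :
    (PathDecomposition.ofKey (wall k) fun v => wallKey k v.1).width ≤ (k : ℤ) + 1 := by
  classical
  rw [← Nat.cast_succ, PathDecomposition.width_le_iff]
  intro p
  obtain ⟨x, y, hx, hp⟩ : ∃ x y, x < k + 3 ∧ (p : ℕ) = y * (k + 3) + x :=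
    ⟨p % (k + 3), p / (k + 3), Nat.mod_lt _ (by omega), (Nat.div_add_mod' _ _).symm⟩
  -- The bag has at most one vertex in each row `x' ≤ k` that waits for its right neighbour in the
  -- row, the vertex `(x, y)`, and one vertex that waits for the end of an edge to the next row.
  let c : Finset (ℕ × ℕ) := insert (x, y)
    (insert (if y % 4 = 2 then (x - 1, if x = k + 2 then y else y - 1) else (k + 1, y - 1))
      ((Finset.Icc 1 k).image fun x' => (x', if x' < x then y else y - 1)))
  have hc : c.card ≤ k + 1 + 1 := by
    refine (Finset.card_insert_le _ _).trans (Nat.succ_le_succ ?_)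
    refine (Finset.card_insert_le _ _).trans (Nat.succ_le_succ ?_)
    exact Finset.card_image_le.trans (by simp)
  refine (Finset.card_le_card_of_injOn Subtype.val (t := c) ?_ Subtype.val_injective.injOn).trans hc
  intro v hv
  simp only [PathDecomposition.ofKey, Finset.coe_filter, Finset.mem_univ, true_and,
    Set.mem_ofPred_eq, hp] at hv
  obtain ⟨hle, hv⟩ := hv
  have hvb := wall_row_bounds v
  have hle' := (mul_add_lt_iff hx (by omega)).not.1 hle.not_gt
  have hmem : ∀ z, z ∈ c ↔ z = (x, y) ∨
      z = (if y % 4 = 2 then (x - 1, if x = k + 2 then y else y - 1) else (k + 1, y - 1)) ∨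
      ∃ x', (1 ≤ x' ∧ x' ≤ k) ∧ (x', if x' < x then y else y - 1) = z := by
    simp [c]
  rw [Finset.mem_coe, hmem]
  rcases hv with heq | ⟨w, hvw, hle2⟩
  · have := (mul_add_lt_iff (by omega) hx).not.1 heq.not_lt
    left
    apply Prod.ext <;> dsimp only <;> omega
  · have hwb := wall_row_bounds w
    have hle2' := (mul_add_lt_iff (by omega) hx).not.1 hle2.not_gt
    rcases WallStep.of_wall_adj hk hvw with h | h
    · by_cases hvk : v.1.1 ≤ k ∧ v.1.2 = if v.1.1 < x then y else y - 1
      · exact Or.inr (Or.inr ⟨v.1.1, ⟨hvb.1, hvk.1⟩, Prod.ext rfl hvk.2.symm⟩)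
      · obtain ⟨h1, h2, h3⟩ := h.mod_four
        by_cases hvxy : v.1 = (x, y)
        · exact Or.inl hvxy
        refine Or.inr (Or.inl ?_)
        have hvxy' : ¬ (v.1.1 = x ∧ v.1.2 = y) := fun h => hvxy (Prod.ext h.1 h.2)
        split_ifs at hvk ⊢ <;> apply Prod.ext <;> dsimp only <;> omega
    · obtain ⟨h1, -, -⟩ := h
      left
      apply Prod.ext <;> dsimp only <;> omega

/-! ### A 2-layer drawing of the wall-like graph -/

theorem exists_equiv_fin_of_injective {α : Type*} [Finite α] (f : α → ℕ)
    (hf : Function.Injective f) :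
    ∃ e : α ≃ Fin (Nat.card α), ∀ a b, e a < e b ↔ f a < f b := by
  have := Fintype.ofFinite α
  let : LinearOrder α := LinearOrder.lift' f hf
  let o := Fintype.orderIsoFinOfCardEq α (k := Nat.card α) Nat.card_eq_fintype_card.symm
  exact ⟨o.symm.toEquiv, fun a b => o.symm.lt_iff_lt⟩

/-- The drawing of the wall-like graph with the even columns on one layer and the odd columns on
the other one, each layer ordered by columns and then by rows. -/
theorem exists_wall_drawing {k : ℕ} (hk : 1 ≤ k) : ∃ D : Drawing (wall k),
    (∀ v : D.X, v.1.1.2 % 2 = 0) ∧ (∀ v : D.Y, v.1.1.2 % 2 = 1) ∧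
    (∀ v w, D.πX v < D.πX w ↔ wallKey k v.1.1 < wallKey k w.1.1) ∧
    (∀ v w, D.πY v < D.πY w ↔ wallKey k v.1.1 < wallKey k w.1.1) := by
  let X : Set (wallVertices k) := {v | v.1.2 % 2 = 0}
  let Y : Set (wallVertices k) := {v | v.1.2 % 2 = 1}
  obtain ⟨eX, heX⟩ := exists_equiv_fin_of_injective (fun v : X => wallKey k v.1.1)
    ((wallKey_injective k).comp Subtype.val_injective)
  obtain ⟨eY, heY⟩ := exists_equiv_fin_of_injective (fun v : Y => wallKey k v.1.1)
    ((wallKey_injective k).comp Subtype.val_injective)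
  refine ⟨⟨X, Y, ⟨?_, ?_⟩, ?_, eX, eY⟩, fun v => v.2, fun v => v.2, heX, heY⟩
  · rw [Set.disjoint_left]
    intro v hv hv'
    simp only [X, Y, Set.mem_ofPred_eq] at hv hv'
    omega
  · intro v w h
    simp only [X, Y, Set.mem_ofPred_eq]
    rcases WallStep.of_wall_adj hk h with h | h <;> have := h.1 <;> omega
  · ext v
    simp only [X, Y, Set.mem_union, Set.mem_ofPred_eq, Set.mem_univ, iff_true]
    omega

/-- Two edges, written from left to right as `(p, q)` and `(p', q')`, that are neighbours in the
sense of the order on the two layers: they lie between consecutive pairs of columns, and in the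
common column the end of the left edge comes after that of the right edge. These are the edges that
cross in the drawing of the wall-like graph. -/
def StepsCross (p q p' q' : ℕ × ℕ) : Prop :=
  (p'.2 = p.2 + 1 ∧ p'.1 < q.1) ∨ (p.2 = p'.2 + 1 ∧ p.1 < q'.1)

/-- The row in which a crossing of an edge with the edge `(p, q)` is counted: the row of `(p, q)`
if this is a row edge, and otherwise the row `a`, which is to be that of the left end of the other
edge. -/
def crossingRow (a : ℕ) (p q : ℕ × ℕ) : ℕ := if q.1 = p.1 then p.1 else a

theorem WallStep.crossingRow_mem {k : ℕ} {p q p' q' : ℕ × ℕ} (h : WallStep k p q)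
    (h' : WallStep k p' q') (hc : StepsCross p q p' q') :
    crossingRow p.1 p' q' ∈ Finset.Icc 1 k := by
  have h1 := h.mod_four
  have h2 := h'.mod_four
  rw [Finset.mem_Icc]
  unfold StepsCross at hc
  unfold crossingRow
  split_ifs <;> omega

/-- The edges that cross a given edge are counted in different rows. An edge from row `x` to row
`x + 1` crosses only row edges: those of the rows `≤ x` to its right and those of the rows `> x` to
its left. An edge of row `x` crosses at most one edge of each other row and at most one edge that
changes the row, as such edges are too far apart; the latter is counted in row `x`. -/
theorem WallStep.crossingRow_injective {k : ℕ} {p q p₁ q₁ p₂ q₂ : ℕ × ℕ} (h : WallStep k p q)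
    (h₁ : WallStep k p₁ q₁) (h₂ : WallStep k p₂ q₂) (hc₁ : StepsCross p q p₁ q₁)
    (hc₂ : StepsCross p q p₂ q₂) (heq : crossingRow p.1 p₁ q₁ = crossingRow p.1 p₂ q₂) :
    p₁ = p₂ ∧ q₁ = q₂ := by
  have hm := h.mod_four
  have hm₁ := h₁.mod_four
  have hm₂ := h₂.mod_four
  unfold StepsCross at hc₁ hc₂
  unfold crossingRow at heq
  have hrow : p₁.1 = p₂.1 := by
    by_cases hv : q₁.1 = p₁.1 + 1 ∧ q₂.1 = p₂.1 + 1 ∧ p₁.1 ≤ k ∧ p₂.1 ≤ k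
    · obtain ⟨e₁, e₂, l₁, l₂⟩ := hv
      have hy : p₁.2 = p₂.2 := by omega
      obtain ⟨-, b₁, ⟨n₁, -⟩ | ⟨-, ⟨-, s₁, f₁⟩ | ⟨n₁, -⟩⟩⟩ := h₁
      · omega
      · obtain ⟨-, b₂, ⟨n₂, -⟩ | ⟨-, ⟨-, s₂, f₂⟩ | ⟨n₂, -⟩⟩⟩ := h₂
        · omega
        · exact (eq_of_mul_add_eq (by omega) b₁ l₁ b₂ l₂ : s₁ = s₂ ∧ p₁.1 = p₂.1).2
        · omega
      · omega
    · split_ifs at heq <;> omega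
  split_ifs at heq <;> exact ⟨Prod.ext hrow (by omega), Prod.ext (by omega) (by omega)⟩

theorem wall_isKPlanar {k : ℕ} (hk : 1 ≤ k) : IsKPlanar (wall k) k := by
  obtain ⟨D, hX, hY, hπX, hπY⟩ := exists_wall_drawing hk
  refine ⟨D, fun e he => ?_⟩
  have hstep : ∀ f : D.X × D.Y, (wall k).Adj f.1 f.2 → ∃ p q : ℕ × ℕ, WallStep k p q ∧
      ((p = f.1.1.1 ∧ q = f.2.1.1) ∨ (p = f.2.1.1 ∧ q = f.1.1.1)) := by
    intro f hf
    rcases WallStep.of_wall_adj hk hf with h | h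
    · exact ⟨_, _, h, Or.inl ⟨rfl, rfl⟩⟩
    · exact ⟨_, _, h, Or.inr ⟨rfl, rfl⟩⟩
  choose! left right hstep hends using hstep
  have hcross : ∀ f, (wall k).Adj f.1 f.2 → D.Crosses e f →
      StepsCross (left e) (right e) (left f) (right f) := by
    intro f hf hef
    have he1 := (hstep e he).mod_four
    have hf1 := (hstep f hf).mod_four
    have := hX e.1
    have := hX f.1
    have := hY e.2
    have := hY f.2
    simp only [Drawing.Crosses, hπX, hπY, wallKey_lt_iff] at hef
    unfold StepsCross
    rcases hends e he with ⟨h1, h2⟩ | ⟨h1, h2⟩ <;> rcases hends f hf with ⟨h3, h4⟩ | ⟨h3, h4⟩ <;>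
      rw [h1, h2] at he1 <;> rw [h3, h4] at hf1 <;> rw [h1, h2, h3, h4] <;> omega
  have hcard : (Finset.Icc 1 k : Set ℕ).ncard = k := by
    rw [Set.ncard_coe_finset]
    simp
  refine (Set.ncard_le_ncard_of_injOn (fun f => crossingRow (left e).1 (left f) (right f))
    (fun f hf => (hstep e he).crossingRow_mem (hstep f hf.1) (hcross f hf.1 hf.2)) ?_
    (Finset.finite_toSet _)).trans_eq hcard
  intro f hf g hg hfg
  obtain ⟨hl, hr⟩ := (hstep e he).crossingRow_injective (hstep f hf.1) (hstep g hg.1)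
    (hcross f hf.1 hf.2) (hcross g hg.1 hg.2) hfg
  have hf1 := hX f.1
  have hf2 := hY f.2
  have hg1 := hX g.1
  have hg2 := hY g.2
  -- The layers of the ends of `f` and `g` are determined by the parities of the columns.
  have hfg : f.1.1.1 = g.1.1.1 ∧ f.2.1.1 = g.2.1.1 := by
    rcases hends f hf.1 with ⟨h1, h2⟩ | ⟨h1, h2⟩ <;> rcases hends g hg.1 with ⟨h3, h4⟩ | ⟨h3, h4⟩
    · exact ⟨h1.symm.trans (hl.trans h3), h2.symm.trans (hr.trans h4)⟩
    · rw [h1, h3] at hl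
      rw [hl] at hf1
      omega
    · rw [h1, h3] at hl
      rw [hl] at hf2
      omega
    · exact ⟨h2.symm.trans (hr.trans h4), h1.symm.trans (hl.trans h3)⟩
  exact Prod.ext (Subtype.ext (Subtype.ext hfg.1)) (Subtype.ext (Subtype.ext hfg.2))

/-! ### The grid-like graph as a minor of the wall-like graph -/

theorem row_mem_wallVertices {k s x y : ℕ} (hx : 1 ≤ x) (hxk : x ≤ k) (hs : s + 1 ≤ 3 * k + 6)
    (hy : 1 ≤ y) (hys : y ≤ 4 * k * s + 4 * k) : (x, y) ∈ wallVertices k :=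
  mem_wallVertices.2 (Or.inl ⟨⟨hx, hxk⟩, hy, hys.trans (Nat.mul_le_mul_left (4 * k) hs)⟩)

/-- The branch set of the vertex `(x, t)` of the grid-like graph in the wall-like graph: the `t`-th
block of `4 * k` columns, restricted to the row `x`. -/
def branchSet (k : ℕ) (u : ℕ × ℕ) : Set (wallVertices k) :=
  {v | v.1.1 = u.1 ∧ 4 * k * (u.2 - 1) < v.1.2 ∧ v.1.2 ≤ 4 * k * (u.2 - 1) + 4 * k}

theorem block_unique {m s s' y : ℕ} (h1 : m * s < y) (h2 : y ≤ m * s + m)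
    (h3 : m * s' < y) (h4 : y ≤ m * s' + m) : s = s' :=
  (eq_of_mul_add_eq (k := m) (c := y - m * s) (c' := y - m * s') (by omega) (by omega) (by omega)
    (by omega) (by omega)).1

theorem disjoint_branchSet {k : ℕ} {u v : gridVertices k} (huv : u ≠ v) :
    Disjoint (branchSet k u.1) (branchSet k v.1) := by
  rw [Set.disjoint_left]
  rintro w ⟨h1, h2, h3⟩ ⟨h4, h5, h6⟩
  have h7 := block_unique h2 h3 h5 h6
  have hu := mem_gridVertices.1 u.2
  have hv := mem_gridVertices.1 v.2
  exact huv (Subtype.ext (Prod.ext (h1.symm.trans h4) (by omega)))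

theorem connected_branchSet {k : ℕ} (hk : 1 ≤ k) (u : gridVertices k) :
    ((wall k).induce (branchSet k u.1)).Connected := by
  obtain ⟨⟨x, t⟩, hu⟩ := u
  obtain ⟨⟨hx1, hx2⟩, ht1, ht2⟩ := mem_gridVertices.1 hu
  dsimp only at hx1 hx2 ht1 ht2
  obtain ⟨s, rfl⟩ : ∃ s, t = s + 1 := ⟨t - 1, by omega⟩
  by_cases hxk : x ≤ k
  · refine connected_induce_of_descent (fun v => v.1.2)
      ⟨(x, 4 * k * s + 1), row_mem_wallVertices hx1 hxk ht2 (by omega) (by omega)⟩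
      ⟨rfl, Nat.lt_succ_self _, Nat.add_le_add_left (by omega) _⟩ ?_
    rintro ⟨⟨x', y⟩, hv⟩ ⟨h1, h2, h3⟩
    dsimp only [Nat.add_sub_cancel] at h1 h2 h3
    rw [Nat.add_sub_cancel] at h2 h3
    subst h1
    by_cases hy : y = 4 * k * s + 1
    · left
      simp [hy]
    · refine Or.inr ⟨⟨(x', y - 1), row_mem_wallVertices hx1 hxk ht2 (by omega) (by omega)⟩,
        ⟨rfl, ?_, ?_⟩, ?_, ?_⟩
      · change 4 * k * s < y - 1
        omega
      · change y - 1 ≤ 4 * k * s + 4 * k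
        omega
      · rw [wall, SimpleGraph.fromRel_adj]
        refine ⟨?_, Or.inr (Or.inl ⟨hxk, rfl, ?_⟩)⟩
        · simp only [ne_eq, Subtype.mk.injEq, Prod.mk.injEq, true_and]
          omega
        · change y = y - 1 + 1
          omega
      · change y - 1 < y
        omega
  · -- In the rows `k + 1` and `k + 2`, a block has only one vertex.
    obtain ⟨c, hc, hc4, hmem⟩ : ∃ c, 1 ≤ c ∧ c < 4 ∧ ∀ y, (x, y) ∈ wallVertices k ↔
        ∃ s', s' + 1 ≤ 3 * k + 6 ∧ y = 4 * k * s' + 4 * k - c := by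
      have hex : ∀ (c y : ℕ), (∃ t, (1 ≤ t ∧ t ≤ 3 * k + 6) ∧ y = 4 * k * t - c) ↔
          ∃ s', s' + 1 ≤ 3 * k + 6 ∧ y = 4 * k * s' + 4 * k - c := by
        intro c y
        constructor
        · rintro ⟨t, ⟨h1, h2⟩, h3⟩
          obtain ⟨s', rfl⟩ : ∃ s', t = s' + 1 := ⟨t - 1, by omega⟩
          exact ⟨s', h2, h3⟩
        · rintro ⟨s', h1, h2⟩
          exact ⟨s' + 1, ⟨by omega, h1⟩, h2⟩
      obtain rfl | rfl : x = k + 1 ∨ x = k + 2 := by omega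
      · refine ⟨2, by omega, by omega, fun y => ?_⟩
        rw [mem_wallVertices, ← hex]
        simp
      · refine ⟨1, by omega, by omega, fun y => ?_⟩
        rw [mem_wallVertices, ← hex]
        simp
    refine connected_induce_of_descent (fun v => v.1.2)
      ⟨(x, 4 * k * s + 4 * k - c), (hmem _).2 ⟨s, ht2, rfl⟩⟩ ⟨rfl, ?_, ?_⟩ ?_
    · change 4 * k * s < 4 * k * s + 4 * k - c
      omega
    · exact Nat.sub_le _ _
    rintro ⟨⟨x', y⟩, hv⟩ ⟨h1, h2, h3⟩
    dsimp only at h1 h2 h3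
    rw [Nat.add_sub_cancel] at h2 h3
    subst h1
    obtain ⟨s', -, rfl⟩ := (hmem _).1 hv
    obtain rfl : s = s' := block_unique h2 h3 (by omega) (Nat.sub_le _ _)
    exact Or.inl rfl

theorem exists_adj_branchSet {k : ℕ} (hk : 1 ≤ k) {u v : gridVertices k}
    (h : (v.1.1 = u.1.1 + 1 ∧ v.1.2 = u.1.2) ∨
      (u.1.1 ≤ k ∧ v.1.1 = u.1.1 ∧ v.1.2 = u.1.2 + 1)) :
    ∃ a ∈ branchSet k u.1, ∃ b ∈ branchSet k v.1, (wall k).Adj a b := by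
  obtain ⟨⟨x, t⟩, hu⟩ := u
  obtain ⟨⟨x', t'⟩, hv⟩ := v
  obtain ⟨⟨hx1, hx2⟩, ht1, ht2⟩ := mem_gridVertices.1 hu
  obtain ⟨⟨hx1', hx2'⟩, ht1', ht2'⟩ := mem_gridVertices.1 hv
  dsimp only at *
  obtain ⟨s, rfl⟩ : ∃ s, t = s + 1 := ⟨t - 1, by omega⟩
  have hmul : 4 * k * (s + 1) = 4 * k * s + 4 * k := rfl
  -- It suffices to name the columns of the ends of an edge.
  have key : ∀ y y', (x, y) ∈ wallVertices k → (x', y') ∈ wallVertices k →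
      (4 * k * s < y ∧ y ≤ 4 * k * s + 4 * k) →
      (4 * k * (t' - 1) < y' ∧ y' ≤ 4 * k * (t' - 1) + 4 * k) → y ≠ y' →
      ((x ≤ k ∧ x' = x ∧ y' = y + 1) ∨
        ∃ t ∈ Finset.Icc 1 (3 * k + 6),
          (∃ z ∈ Finset.Icc 1 (k - 1),
            (x, y) = (z, 4 * k * (t - 1) + 4 * z - 3) ∧
            (x', y') = (z + 1, 4 * k * (t - 1) + 4 * z - 2)) ∨
          ((x, y) = (k, 4 * k * t - 3) ∧ (x', y') = (k + 1, 4 * k * t - 2)) ∨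
          ((x, y) = (k + 1, 4 * k * t - 2) ∧ (x', y') = (k + 2, 4 * k * t - 1))) →
      ∃ a ∈ branchSet k (x, s + 1), ∃ b ∈ branchSet k (x', t'), (wall k).Adj a b := by
    intro y y' hy hy' hb hb' hne hr
    refine ⟨⟨_, hy⟩, ⟨rfl, hb⟩, ⟨_, hy'⟩, ⟨rfl, hb'⟩, ?_⟩
    rw [wall, SimpleGraph.fromRel_adj]
    exact ⟨by simp [hne], Or.inl hr⟩
  have ht : s + 1 ∈ Finset.Icc 1 (3 * k + 6) := Finset.mem_Icc.2 ⟨ht1, ht2⟩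
  rcases h with ⟨rfl, rfl⟩ | ⟨hxk, rfl, rfl⟩
  · rw [Nat.add_sub_cancel] at key
    rcases lt_trichotomy x k with hxk | rfl | hxk
    · refine key (4 * k * s + 4 * x - 3) (4 * k * s + 4 * x - 2)
        (row_mem_wallVertices hx1 hxk.le ht2 (by omega) (by omega))
        (row_mem_wallVertices hx1' hxk ht2 (by omega) (by omega))
        (by omega) (by omega) (by omega)
        (Or.inr ⟨s + 1, ht, Or.inl ⟨x, Finset.mem_Icc.2 (by omega), rfl, rfl⟩⟩)
    · refine key (4 * x * (s + 1) - 3) (4 * x * (s + 1) - 2)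
        (row_mem_wallVertices hx1 le_rfl ht2 (by omega) (by omega))
        (mem_wallVertices.2 (Or.inr (Or.inl ⟨s + 1, ⟨ht1, ht2⟩, rfl⟩)))
        (by omega) (by omega) (by omega)
        (Or.inr ⟨s + 1, ht, Or.inr (Or.inl ⟨rfl, rfl⟩)⟩)
    · obtain rfl : x = k + 1 := by omega
      refine key (4 * k * (s + 1) - 2) (4 * k * (s + 1) - 1)
        (mem_wallVertices.2 (Or.inr (Or.inl ⟨s + 1, ⟨ht1, ht2⟩, rfl⟩)))
        (mem_wallVertices.2 (Or.inr (Or.inr ⟨s + 1, ⟨ht1, ht2⟩, rfl⟩)))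
        (by omega) (by omega) (by omega)
        (Or.inr ⟨s + 1, ht, Or.inr (Or.inr ⟨rfl, rfl⟩)⟩)
  · rw [Nat.add_sub_cancel, hmul] at key
    exact key (4 * k * s + 4 * k) (4 * k * s + 4 * k + 1)
      (row_mem_wallVertices hx1 hxk ht2 (by omega) le_rfl)
      (row_mem_wallVertices hx1 hxk ht2' (by omega) (by omega))
      (by omega) (by omega) (by omega) (Or.inl ⟨hxk, rfl, rfl⟩)

theorem grid_isMinor_wall {k : ℕ} (hk : 1 ≤ k) : IsMinor (grid k) (wall k) := by
  refine ⟨fun u => branchSet k u.1, connected_branchSet hk, fun u v => disjoint_branchSet, ?_⟩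
  intro u v huv
  rcases ((SimpleGraph.fromRel_adj _ _ _).1 huv).2 with h | h
  · exact exists_adj_branchSet hk h
  · obtain ⟨a, ha, b, hb, hab⟩ := exists_adj_branchSet hk h
    exact ⟨b, hb, a, ha, hab.symm⟩

/-! ### A single edge -/

theorem isKPlanar_zero_top_bool : IsKPlanar (⊤ : SimpleGraph Bool) 0 := by
  let D : Drawing (⊤ : SimpleGraph Bool) :=
    { X := {false}
      Y := {true}
      isBipartiteWith := ⟨by simp, fun v w h => by cases v <;> cases w <;> simp_all⟩
      union_eq := by
        ext b
        cases b <;> simp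
      πX := Finite.equivFinOfCardEq rfl
      πY := Finite.equivFinOfCardEq rfl }
  have : Subsingleton D.X := inferInstanceAs (Subsingleton ({false} : Set Bool))
  refine ⟨D, fun e he => ?_⟩
  have hempty : {f : D.X × D.Y | (⊤ : SimpleGraph Bool).Adj f.1 f.2 ∧ D.Crosses e f} = ∅ := by
    rw [Set.eq_empty_iff_forall_notMem]
    rintro f ⟨-, h⟩
    rw [Drawing.Crosses, Subsingleton.elim e.1 f.1] at h
    exact h.elim (fun h => lt_irrefl _ h.1) fun h => lt_irrefl _ h.1
  rw [hempty, Set.ncard_empty]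

theorem pathwidth_top_bool : pathwidth (⊤ : SimpleGraph Bool) = 1 := by
  let D : PathDecomposition (⊤ : SimpleGraph Bool) :=
    { n := 0
      bag := fun _ => Finset.univ
      exists_mem := fun v => ⟨0, Finset.mem_univ v⟩
      exists_mem_of_adj := fun u v _ => ⟨0, Finset.mem_univ u, Finset.mem_univ v⟩
      mem_of_le_of_le := fun v _ _ _ _ _ _ _ => Finset.mem_univ v }
  refine pathwidth_eq_of_le_of_forall_le D ?_ fun D' => ?_
  · exact (D.width_le_iff 1).2 fun p => by simp [D]
  · obtain ⟨p, hf, ht⟩ := D'.exists_mem_of_adj false true (by simp)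
    by_contra! h
    have hcard := (D'.width_le_iff 0).1 (by push_cast; omega) p
    exact absurd (Finset.card_le_one.1 hcard _ hf _ ht) (by simp)

end TwoLayer

theorem theorem1 (k : ℕ) :
    (∃ (V : Type) (_ : Finite V) (G : SimpleGraph V),
      TwoLayer.IsKPlanar G k ∧ TwoLayer.pathwidth G = (k : ℤ) + 1) ∧
    (1 ≤ k →
      TwoLayer.IsKPlanar (TwoLayer.wall k) k ∧
      TwoLayer.pathwidth (TwoLayer.wall k) = (k : ℤ) + 1 ∧
      TwoLayer.IsMinor (TwoLayer.grid k) (TwoLayer.wall k)) := by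
  have hpw : 1 ≤ k → TwoLayer.pathwidth (TwoLayer.wall k) = (k : ℤ) + 1 := fun hk =>
    TwoLayer.pathwidth_eq_of_le_of_forall_le _ (TwoLayer.wall_ofKey_width_le hk) fun D =>
      (TwoLayer.grid_isMinor_wall hk).le_width TwoLayer.grid_le_width D
  refine ⟨?_, fun hk => ⟨TwoLayer.wall_isKPlanar hk, hpw hk, TwoLayer.grid_isMinor_wall hk⟩⟩
  rcases Nat.eq_zero_or_pos k with rfl | hk
  · exact ⟨Bool, inferInstance, ⊤, TwoLayer.isKPlanar_zero_top_bool,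
      by simpa using TwoLayer.pathwidth_top_bool⟩
  · exact ⟨TwoLayer.wallVertices k, inferInstance, TwoLayer.wall k, TwoLayer.wall_isKPlanar hk,
      hpw hk⟩
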